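/- Let $\|t\|$ denote the distance of a real number $t$ to the nearest integer. Let $k\ge 1$ be an integer. For $\underline{\zeta}=(\zeta_1,\dots,\zeta_k)\in\mathbb{R}^k$ let $\chi_k(\underline{\zeta})\in[-\infty,\infty]$ be the supremum of all real $\nu>0$ such that the system $$0<\min_{1\le j\le k}|x_j|\le\max_{1\le j\le k}|x_j|\le X,\qquad \max_{1\le j\le k}\|x_j\zeta_j\|\le X^{-\nu}$$ has a solution $(x_1,\dots,x_k)\in\mathbb{Z}^k$ for arbitrarily large real $X$. Let $T_k\subseteq\mathbb{R}^k$ be the set of all $\underline{\zeta}$ for which $1,\zeta_1,\dots,\zeta_k$ are linearly independent over $\mathbb{Q}$. Then the spectrum of $\chi_k$, i.e. the set of values taken by $\chi_k$ on $T_k$, is exactly $[1,\infty]$ (with $\infty$ included): $$\{\chi_k(\underline{\zeta}):\underline{\zeta}\in T_k\}=[1,\infty].$$ -/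

import Mathlib

open Filter

/-- The distance `‖t‖` of a real number `t` to the nearest integer. -/
noncomputable def distNearestInt (t : ℝ) : ℝ := |t - (round t : ℝ)|

/-- The set `𝒵ᵏ_ψ` of all `ζ ∈ ℝᵏ` such that, for arbitrarily large real `X`, the system
`0 < min_j |x_j| ≤ max_j |x_j| ≤ X`, `max_j ‖x_j ζ_j‖ ≤ ψ(X)` has a solution `x ∈ ℤᵏ`. -/
def approxSet (k : ℕ) (ψ : ℝ → ℝ) : Set (Fin k → ℝ) :=
  {ζ | ∃ᶠ X : ℝ in atTop, ∃ x : Fin k → ℤ,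
    (∀ j, 0 < |(x j : ℝ)| ∧ |(x j : ℝ)| ≤ X) ∧
    ∀ j, distNearestInt ((x j : ℝ) * ζ j) ≤ ψ X}

/-- The exponent `χ_k(ζ)`: the supremum in `[-∞, ∞]` of all real `ν > 0` such that
`ζ ∈ 𝒵ᵏ_ψ` for `ψ(t) = t ^ (-ν)`. -/
noncomputable def chi {k : ℕ} (ζ : Fin k → ℝ) : EReal :=
  sSup {e : EReal | ∃ ν : ℝ, 0 < ν ∧ ζ ∈ approxSet k (fun t => t ^ (-ν)) ∧ e = (ν : EReal)}

/-- The set `T_k` of all `ζ ∈ ℝᵏ` for which `1, ζ_1, …, ζ_k` are linearly independent over `ℚ`. -/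
def independentWithOne (k : ℕ) : Set (Fin k → ℝ) :=
  {ζ | LinearIndependent ℚ (Fin.cons 1 ζ : Fin (k + 1) → ℝ)}

/-- The spectrum of `χ_k`: the set of values taken by `χ_k` on `T_k`. -/
noncomputable def chiSpectrum (k : ℕ) : Set EReal :=
  {e | ∃ ζ ∈ independentWithOne k, chi ζ = e}

/-! The integers `x j` may be chosen separately and share only the bound `X`. Dirichlet's theorem in
each coordinate thus gives `1 ≤ chi ζ`, while one badly approximable coordinate bounds `chi ζ` from
above. For finite `w`, a continued fraction with denominators growing like `q ↦ q ^ w` yields a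
first coordinate of exact order `w`. Further coordinates come from Baire category: being
approximable along infinitely many of the `X` already in use is generic, so each new one can avoid
the countable rational span of the earlier ones. For `⊤` the same extension is run with `ψ X = X ^
(-X)`. -/

theorem distNearestInt_le_abs_sub (t : ℝ) (y : ℤ) : distNearestInt t ≤ |t - y| :=
  round_le t y

/-- Along any unbounded set of `X`, the numbers that are `ψ`-approximable with denominators at most
`X` for arbitrarily large `X` of that set are dense of type `Gδ`, so they leave every countable
set. -/
theorem exists_notMem_countable_frequently_approx {P : ℝ → Prop} (hP : ∃ᶠ X in atTop, P X)
    {ψ : ℝ → ℝ} (hψ : ∀ X, 0 < X → 0 < ψ X) {C : Set ℝ} (hC : C.Countable) :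
    ∃ η : ℝ, η ∉ C ∧ ∃ᶠ X in atTop, P X ∧
      ∃ x : ℤ, (0 < |(x : ℝ)| ∧ |(x : ℝ)| ≤ X) ∧ distNearestInt (x * η) ≤ ψ X := by
  let V : ℕ → Set ℝ := fun N => {η | ∃ X : ℝ, N ≤ X ∧ P X ∧ ∃ x y : ℤ,
    (0 < |(x : ℝ)| ∧ |(x : ℝ)| ≤ X) ∧ |x * η - y| < ψ X}
  have hopen : ∀ N, IsOpen (V N) := by
    intro N
    rw [isOpen_iff_mem_nhds]
    rintro η ⟨X, hNX, hPX, x, y, hx, hη⟩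
    have hcont : Continuous fun t : ℝ => |x * t - y| := by fun_prop
    filter_upwards [hcont.continuousAt.eventually_lt continuousAt_const hη] with t ht
    exact ⟨X, hNX, hPX, x, y, hx, ht⟩
  have hdense : ∀ N, Dense (V N) := by
    intro N
    -- Every rational lies in `V N`: its denominator makes the error zero.
    refine Rat.denseRange_cast.mono ?_
    rintro _ ⟨r, rfl⟩
    obtain ⟨X, hX, hPX⟩ := (frequently_atTop.mp hP) (max (N : ℝ) r.den)
    have hden : (0 : ℝ) < r.den := by exact_mod_cast r.den_pos
    have hdX : (r.den : ℝ) ≤ X := (le_max_right _ _).trans hX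
    refine ⟨X, (le_max_left _ _).trans hX, hPX, r.den, r.num, ?_, ?_⟩
    · simpa using ⟨r.den_pos, hdX⟩
    · have : ((r.den : ℤ) : ℝ) * (r : ℝ) - r.num = 0 := by
        rw [sub_eq_zero, Rat.cast_def]
        push_cast
        field_simp
      rw [this, abs_zero]
      exact hψ X (hden.trans_le hdX)
  have hbaire : Dense ((⋂ N, V N) ∩ Cᶜ) :=
    Dense.inter_of_Gδ (IsGδ.iInter_of_isOpen hopen) hC.isGδ_compl
      (dense_iInter_of_isOpen_nat hopen hdense) (hC.dense_compl ℝ)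
  obtain ⟨η, hη, hηC⟩ := hbaire.nonempty
  refine ⟨η, hηC, frequently_atTop.mpr fun A => ?_⟩
  obtain ⟨N, hN⟩ := exists_nat_ge A
  obtain ⟨X, hNX, hPX, x, y, hx, hxy⟩ := Set.mem_iInter.mp hη N
  exact ⟨X, hN.trans hNX, hPX, x, hx, (distNearestInt_le_abs_sub _ y).trans hxy.le⟩

theorem countable_span_range_rat {n : ℕ} (v : Fin n → ℝ) :
    (Submodule.span ℚ (Set.range v) : Set ℝ).Countable := by
  rw [← Fintype.range_linearCombination ℚ v]
  exact Set.countable_range _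

/-- A real number that is irrational and `ψ`-approximable is the first coordinate of some
independent `ψ`-approximable point of every dimension. -/
theorem exists_independentWithOne_approxSet {ψ : ℝ → ℝ} (hψ : ∀ X, 0 < X → 0 < ψ X) {ξ : ℝ}
    (hξ : Irrational ξ) (hξψ : (fun _ => ξ) ∈ approxSet 1 ψ) (m : ℕ) :
    ∃ ζ ∈ independentWithOne (m + 1), ζ 0 = ξ ∧ ζ ∈ approxSet (m + 1) ψ := by
  induction m with
  | zero =>
    refine ⟨fun _ => ξ, ?_, rfl, hξψ⟩
    have h1 : LinearIndependent ℚ (fun _ : Fin 1 => (1 : ℝ)) := by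
      rw [linearIndependent_unique_iff]
      exact one_ne_zero
    have h := h1.finSnoc (x := ξ) (by
      intro hmem
      rw [Set.range_const, Submodule.mem_span_singleton] at hmem
      obtain ⟨a, ha⟩ := hmem
      exact hξ ⟨a, by rw [← ha, Rat.smul_def, mul_one]⟩)
    unfold independentWithOne
    rw [Set.mem_ofPred_eq]
    convert! h using 1
    ext i
    fin_cases i <;> rfl
  | succ m ih =>
    obtain ⟨ζ, hind, h0, happ⟩ := ih
    -- Taking for `P` the solvability for `ζ` makes the old and new coordinates approximable at the
    -- same `X`.
    obtain ⟨η, hη, hfreq⟩ := exists_notMem_countable_frequently_approx happ hψ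
      (countable_span_range_rat (Fin.cons 1 ζ : Fin (m + 1 + 1) → ℝ))
    refine ⟨Fin.snoc ζ η, ?_, ?_, ?_⟩
    · unfold independentWithOne
      rw [Set.mem_ofPred_eq, Fin.cons_snoc_eq_snoc_cons]
      exact LinearIndependent.finSnoc hind hη
    · rw [← h0]
      exact Fin.snoc_castSucc (α := fun _ => ℝ) η ζ 0
    · refine hfreq.mono ?_
      rintro X ⟨⟨x, hx, hxζ⟩, y, hy, hyη⟩
      refine ⟨Fin.snoc x y, fun j => ?_, fun j => ?_⟩
      · refine Fin.lastCases ?_ (fun i => ?_) j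
        · simpa using hy
        · simpa using hx i
      · refine Fin.lastCases ?_ (fun i => ?_) j
        · simpa using hyη
        · simpa using hxζ i

/-! ### Continued fractions of prescribed order -/

/-- Consecutive convergents of a continued fraction whose denominators grow like `q ↦ q ^ w`. -/
theorem exists_convergents {w : ℝ} (hw : 1 ≤ w) :
    ∃ p q : ℕ → ℤ, q 0 = 1 ∧ ∀ n, 1 ≤ q n ∧ 4 * (q n : ℝ) ^ w ≤ q (n + 1) ∧
      (q (n + 1) : ℝ) ≤ 6 * (q n : ℝ) ^ w ∧ |p n * q (n + 1) - p (n + 1) * q n| = 1 := by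
  let S := {s : (ℤ × ℤ) × (ℤ × ℤ) //
    0 ≤ s.1.2 ∧ s.1.2 ≤ s.2.2 ∧ 1 ≤ s.2.2 ∧ |s.1.1 * s.2.2 - s.2.1 * s.1.2| = 1}
  have step : ∀ s : S, ∃ t : S, t.1.1 = s.1.2 ∧ 4 * (s.1.2.2 : ℝ) ^ w ≤ t.1.2.2 ∧
      (t.1.2.2 : ℝ) ≤ 6 * (s.1.2.2 : ℝ) ^ w := by
    rintro ⟨⟨⟨p, q⟩, p', q'⟩, h0, hle, h1, hdet⟩
    dsimp only at h0 hle h1 hdet ⊢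
    have h1' : (1 : ℝ) ≤ q' := by exact_mod_cast h1
    have h0' : (0 : ℝ) ≤ q := by exact_mod_cast h0
    have hle' : (q : ℝ) ≤ q' := by exact_mod_cast hle
    have hpow : (q' : ℝ) ^ w = (q' : ℝ) ^ (w - 1) * q' := by
      rw [← Real.rpow_add_one (by positivity), sub_add_cancel]
    have hge : (1 : ℝ) ≤ (q' : ℝ) ^ (w - 1) := Real.one_le_rpow h1' (by linarith)
    -- The next partial quotient. Since `q ≤ q'`, the new denominator is at most `4 * q' ^ w + 2 *
    -- q'`, whence the constant 6.
    set a : ℤ := ⌈4 * (q' : ℝ) ^ (w - 1)⌉ with ha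
    have ha1 : 4 * (q' : ℝ) ^ (w - 1) ≤ a := Int.le_ceil _
    have ha2 : (a : ℝ) < 4 * (q' : ℝ) ^ (w - 1) + 1 := Int.ceil_lt_add_one _
    have ha3 : 1 ≤ a := by
      have : (1 : ℝ) ≤ a := by linarith
      exact_mod_cast this
    refine ⟨⟨((p', q'), (a * p' + p, a * q' + q)), zero_le_one.trans h1, ?_, ?_, ?_⟩, rfl, ?_, ?_⟩
    · dsimp only; nlinarith
    · dsimp only; nlinarith
    · dsimp only
      rw [← hdet, abs_sub_comm]
      congr 1
      ring
    · dsimp only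
      push_cast
      rw [hpow]
      nlinarith
    · dsimp only
      push_cast
      rw [hpow]
      nlinarith
  choose f hf1 hf2 hf3 using step
  -- The formal convergents 1/0 and 0/1; the sequence reads the second of each pair, so `q 0 = 1`.
  let s0 : S := ⟨((1, 0), (0, 1)), by simp⟩
  let s : ℕ → S := fun n => f^[n] s0
  have hs : ∀ n, s (n + 1) = f (s n) := fun n => Function.iterate_succ_apply' f n s0
  refine ⟨fun n => (s n).1.2.1, fun n => (s n).1.2.2, rfl, fun n => ⟨(s n).2.2.2.1, ?_, ?_, ?_⟩⟩
  · dsimp only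
    rw [hs]
    exact hf2 _
  · dsimp only
    rw [hs]
    exact hf3 _
  · have h := (s (n + 1)).2.2.2.2
    rwa [show (s (n + 1)).1.1 = (s n).1.2 by rw [hs]; exact hf1 _] at h

/-- For `w ≥ 1` some real number is approximable exactly to the order `w`. -/
theorem exists_approx_order {w : ℝ} (hw : 1 ≤ w) :
    ∃ ξ : ℝ, ((fun _ => ξ) ∈ approxSet 1 fun X => X ^ (-w)) ∧
      ∀ x : ℤ, x ≠ 0 → ∀ y : ℤ, (1 / 12) * |(x : ℝ)| ^ (-w) ≤ |x * ξ - y| := by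
  obtain ⟨p, q, hq0, h⟩ := exists_convergents hw
  choose hq1 hlo hhi hdet using h
  have hq1' : ∀ n, (1 : ℝ) ≤ q n := fun n => by exact_mod_cast hq1 n
  have hqpos : ∀ n, (0 : ℝ) < q n := fun n => one_pos.trans_le (hq1' n)
  have hq4 : ∀ n, 4 * (q n : ℝ) ≤ q (n + 1) := fun n =>
    (mul_le_mul_of_nonneg_left (Real.self_le_rpow_of_one_le (hq1' n) hw) (by norm_num)).trans
      (hlo n)
  have hqge : ∀ n : ℕ, (n : ℝ) + 1 ≤ q n := by
    intro n
    induction n with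
    | zero => simp [hq0]
    | succ n ih =>
      push_cast
      linarith [hq4 n, hq1' n]
  let u : ℕ → ℝ := fun n => p n / q n
  have hdist : ∀ n, dist (u n) (u (n + 1)) = 1 / (q n * q (n + 1)) := by
    intro n
    have h1 : |(p n : ℝ) * q (n + 1) - p (n + 1) * q n| = 1 := by exact_mod_cast hdet n
    have h2 := hqpos n
    have h3 := hqpos (n + 1)
    have h4 : u n - u (n + 1) = (p n * q (n + 1) - p (n + 1) * q n) / (q n * q (n + 1)) := by
      simp only [u]
      field_simp
    rw [Real.dist_eq, h4, abs_div, h1, abs_of_pos (mul_pos h2 h3)]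
  have hgeom : ∀ n m, dist (u (n + m)) (u (n + (m + 1))) ≤
      1 / (q n * q (n + 1)) * (1 / 2 : ℝ) ^ m := by
    intro n m
    induction m with
    | zero => simpa using (hdist n).le
    | succ m ih =>
      refine le_trans ?_ (le_trans (mul_le_mul_of_nonneg_right ih
        (by norm_num : (0 : ℝ) ≤ 1 / 2)) (by rw [pow_succ, mul_assoc]))
      rw [← add_assoc n m 1, ← add_assoc n (m + 1) 1, ← add_assoc n m 1, hdist, hdist]
      have h1 := hqpos (n + m)
      have h2 := hqpos (n + m + 1)
      have h3 := hqpos (n + m + 1 + 1)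
      have h4 := hq4 (n + m)
      have h5 := hq4 (n + m + 1)
      rw [div_mul_div_comm, one_mul, div_le_div_iff₀ (by positivity) (by positivity)]
      nlinarith [mul_pos h1 h2]
  have hcau : CauchySeq u :=
    cauchySeq_of_le_geometric (1 / 2) (1 / (q 0 * q 1)) (by norm_num) fun m => by
      simpa only [zero_add] using hgeom 0 m
  obtain ⟨ξ, hξ⟩ := cauchySeq_tendsto_of_complete hcau
  have hlim : ∀ n, |ξ - u n| ≤ 2 / (q n * q (n + 1)) := by
    intro n
    have ht : Tendsto (fun m => u (n + m)) atTop (nhds ξ) := by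
      simpa only [add_comm n] using (tendsto_add_atTop_iff_nat n).mpr hξ
    have := dist_le_of_le_geometric_of_tendsto₀ _ _ (by norm_num) (hgeom n) ht
    rw [dist_comm, Real.dist_eq] at this
    refine this.trans_eq ?_
    ring
  refine ⟨ξ, frequently_atTop.mpr fun A => ?_, fun x hx y => ?_⟩
  · obtain ⟨n, hn⟩ := exists_nat_ge A
    have hn0 := hqpos n
    have hn1 := hqpos (n + 1)
    refine ⟨q n, by linarith [hqge n], fun _ => q n, fun _ => ?_, fun _ => ?_⟩
    · rw [abs_of_pos hn0]
      exact ⟨hn0, le_rfl⟩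
    · refine (distNearestInt_le_abs_sub _ (p n)).trans ?_
      have h1 : (q n : ℝ) * ξ - p n = q n * (ξ - u n) := by
        simp only [u]
        field_simp
      have hw0 : (0 : ℝ) < (q n : ℝ) ^ w := Real.rpow_pos_of_pos hn0 w
      dsimp only
      rw [h1, abs_mul, abs_of_pos hn0, Real.rpow_neg hn0.le]
      calc (q n : ℝ) * |ξ - u n| ≤ q n * (2 / (q n * q (n + 1))) :=
            mul_le_mul_of_nonneg_left (hlim n) hn0.le
        _ = 2 / q (n + 1) := by field_simp
        _ ≤ ((q n : ℝ) ^ w)⁻¹ := by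
            rw [inv_eq_one_div, div_le_div_iff₀ hn1 hw0]
            linarith [hlo n]
  · have hx1 : (1 : ℝ) ≤ |(x : ℝ)| := by exact_mod_cast Int.one_le_abs hx
    have hex : ∃ m, |(x : ℝ)| < q m := by
      obtain ⟨m, hm⟩ := exists_nat_ge |(x : ℝ)|
      exact ⟨m, by linarith [hqge m]⟩
    -- Since `q (n + 1)` cannot divide `x`, replacing `ξ` by `u (n + 1)` gives distance at least `1
    -- / q (n + 1)`. The replacement costs at most half of this, and `q (n + 1) ≤ 6 * q n ^ w` then
    -- gives 1/12.
    obtain ⟨n, hn, hlt⟩ : ∃ n, (q n : ℝ) ≤ |(x : ℝ)| ∧ |(x : ℝ)| < q (n + 1) := by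
      classical
      have hmin := Nat.find_spec hex
      rcases hm : Nat.find hex with _ | n
      · rw [hm, hq0, Int.cast_one] at hmin
        linarith
      · rw [hm] at hmin
        exact ⟨n, not_lt.mp (Nat.find_min hex (hm ▸ n.lt_succ_self)), hmin⟩
    have hn0 := hqpos n
    have hn1 := hqpos (n + 1)
    have hn2 := hqpos (n + 2)
    have hcop : IsCoprime (q (n + 1)) (p (n + 1)) := by
      rcases (abs_eq zero_le_one).mp (hdet n) with h | h
      · exact ⟨p n, -q n, by linarith⟩
      · exact ⟨-p n, q n, by linarith⟩
    have hne : x * p (n + 1) - y * q (n + 1) ≠ 0 := by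
      intro h0
      have hdvd : q (n + 1) ∣ x := hcop.dvd_of_dvd_mul_right ⟨y, by linarith⟩
      have hle : q (n + 1) ≤ |x| := Int.le_of_dvd (abs_pos.mpr hx) ((dvd_abs _ _).mpr hdvd)
      have : (q (n + 1) : ℝ) ≤ |(x : ℝ)| := by exact_mod_cast hle
      linarith
    have hone : (1 : ℝ) ≤ |(x : ℝ) * p (n + 1) - y * q (n + 1)| := by
      exact_mod_cast Int.one_le_abs hne
    have h1 : 1 / (q (n + 1) : ℝ) ≤ |x * u (n + 1) - y| := by
      have : (x : ℝ) * u (n + 1) - y = (x * p (n + 1) - y * q (n + 1)) / q (n + 1) := by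
        simp only [u]
        field_simp
      rw [this, abs_div, abs_of_pos hn1]
      gcongr
    have h2 : |(x : ℝ) * (ξ - u (n + 1))| ≤ 1 / (2 * q (n + 1)) := by
      rw [abs_mul]
      calc |(x : ℝ)| * |ξ - u (n + 1)| ≤ q (n + 1) * (2 / (q (n + 1) * q (n + 2))) :=
            mul_le_mul hlt.le (hlim _) (abs_nonneg _) hn1.le
        _ = 2 / q (n + 2) := by field_simp
        _ ≤ 1 / (2 * q (n + 1)) := by
            rw [div_le_div_iff₀ hn2 (by positivity)]
            linarith [hq4 (n + 1)]
    have h3 : |(x : ℝ) * u (n + 1) - y| ≤ |x * ξ - y| + |(x : ℝ) * (ξ - u (n + 1))| := by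
      rw [show (x : ℝ) * u (n + 1) - y = (x * ξ - y) - x * (ξ - u (n + 1)) by ring]
      exact abs_sub _ _
    have h4 : (1 / (q (n + 1) : ℝ)) - 1 / (2 * q (n + 1)) = 1 / (2 * q (n + 1)) := by
      field_simp
      norm_num
    refine le_trans ?_ (by linarith : 1 / (2 * (q (n + 1) : ℝ)) ≤ |x * ξ - y|)
    have hxw : (0 : ℝ) < |(x : ℝ)| ^ w := Real.rpow_pos_of_pos (by linarith) w
    have h5 : (q n : ℝ) ^ w ≤ |(x : ℝ)| ^ w :=
      Real.rpow_le_rpow hn0.le hn (by linarith)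
    rw [Real.rpow_neg (abs_nonneg _), ← one_div, div_mul_div_comm, one_mul,
      div_le_div_iff₀ (by positivity) (by positivity)]
    linarith [hhi n]

/-! ### Bounds for the exponent and the values attained -/

theorem le_chi {k : ℕ} {ζ : Fin k → ℝ} {ν : ℝ} (hν : 0 < ν)
    (h : ζ ∈ approxSet k fun t => t ^ (-ν)) : (ν : EReal) ≤ chi ζ :=
  le_sSup ⟨ν, hν, h, rfl⟩

theorem one_le_chi {k : ℕ} (ζ : Fin k → ℝ) : 1 ≤ chi ζ := by
  refine le_chi one_pos (frequently_atTop.mpr fun A => ?_)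
  obtain ⟨n, hn⟩ := exists_nat_ge A
  have hn1 : (0 : ℝ) < (n + 1 : ℕ) := by positivity
  refine ⟨(n + 1 : ℕ), by push_cast; linarith, ?_⟩
  choose x hx0 hxn hx using fun j => Real.exists_nat_abs_mul_sub_round_le (ζ j) n.succ_pos
  refine ⟨fun j => x j, fun j => ?_, fun j => ?_⟩
  · have h1 : (0 : ℝ) < x j := by exact_mod_cast hx0 j
    have h2 : (x j : ℝ) ≤ (n + 1 : ℕ) := by exact_mod_cast hxn j
    simpa only [Int.cast_natCast, Nat.abs_cast] using ⟨h1, h2⟩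
  · dsimp only
    rw [Real.rpow_neg_one, ← one_div, Int.cast_natCast]
    refine (hx j).trans (one_div_le_one_div_of_le hn1 ?_)
    simp

/-- The condition `0 < |x j|` forces every coordinate to be approximated nontrivially, so a single
one suffices. An exponent `ν > w` would require `c ≤ X ^ (-(ν - w))` for arbitrarily large `X`. -/
theorem chi_le_of_forall_le {k : ℕ} {ζ : Fin k → ℝ} {c w : ℝ} (hc : 0 < c) (hw : 0 ≤ w)
    (j : Fin k) (h : ∀ x : ℤ, x ≠ 0 → ∀ y : ℤ, c * |(x : ℝ)| ^ (-w) ≤ |x * ζ j - y|) :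
    chi ζ ≤ w := by
  refine sSup_le ?_
  rintro _ ⟨ν, -, hν, rfl⟩
  rw [EReal.coe_le_coe_iff]
  by_contra! hlt
  have hsmall : ∀ᶠ X : ℝ in atTop, X ^ (-(ν - w)) < c :=
    (tendsto_rpow_neg_atTop (sub_pos.mpr hlt)).eventually_lt_const hc
  obtain ⟨X, ⟨x, hx, hxζ⟩, hX⟩ := (hν.and_eventually hsmall).exists
  have hx0 := (hx j).1
  have hX0 : 0 < X := hx0.trans_le (hx j).2
  have h1 : c * |(x j : ℝ)| ^ (-w) ≤ X ^ (-ν) :=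
    (h (x j) (by rintro h0; simp [h0] at hx0) _).trans (hxζ j)
  have h2 : X ^ (-w) ≤ |(x j : ℝ)| ^ (-w) :=
    Real.rpow_le_rpow_of_nonpos hx0 (hx j).2 (by linarith)
  have h3 : X ^ (-ν) = X ^ (-(ν - w)) * X ^ (-w) := by
    rw [← Real.rpow_add hX0]
    congr 1
    ring
  have h4 := mul_le_mul_of_nonneg_left h2 hc.le
  have h5 := mul_lt_mul_of_pos_right hX (Real.rpow_pos_of_pos hX0 (-w))
  linarith

theorem irrational_of_forall_lt {ξ : ℝ} (h : ∀ x : ℤ, x ≠ 0 → ∀ y : ℤ, 0 < |x * ξ - y|) :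
    Irrational ξ := by
  rintro ⟨r, rfl⟩
  have hden : (r.den : ℝ) ≠ 0 := by exact_mod_cast r.den_ne_zero
  refine (h r.den (by exact_mod_cast r.den_ne_zero) r.num).ne' ?_
  rw [abs_eq_zero, sub_eq_zero, Rat.cast_def]
  push_cast
  field_simp

theorem coe_mem_chiSpectrum_succ {w : ℝ} (hw : 1 ≤ w) (m : ℕ) :
    (w : EReal) ∈ chiSpectrum (m + 1) := by
  obtain ⟨ξ, happ, hbound⟩ := exists_approx_order hw
  have hirr : Irrational ξ := irrational_of_forall_lt fun x hx y =>
    lt_of_lt_of_le (mul_pos (by norm_num)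
      (Real.rpow_pos_of_pos (by exact_mod_cast abs_pos.mpr hx) _)) (hbound x hx y)
  obtain ⟨ζ, hind, h0, hζ⟩ := exists_independentWithOne_approxSet
    (fun X hX => Real.rpow_pos_of_pos hX (-w)) hirr happ m
  refine ⟨ζ, hind, le_antisymm ?_ (le_chi (by linarith) hζ)⟩
  exact chi_le_of_forall_le (by norm_num) (by linarith) 0 (h0 ▸ hbound)

/-- The function `X ^ (-X)` is eventually below every `X ^ (-ν)`, so no finite exponent bounds `chi
ζ`. -/
theorem top_mem_chiSpectrum_succ (m : ℕ) : ⊤ ∈ chiSpectrum (m + 1) := by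
  have hψ : ∀ X : ℝ, 0 < X → 0 < X ^ (-X) := fun X hX => Real.rpow_pos_of_pos hX _
  obtain ⟨ξ, hξ, hfreq⟩ := exists_notMem_countable_frequently_approx (P := fun _ => True)
    (frequently_atTop.mpr fun A => ⟨A, le_rfl, trivial⟩) hψ
    (Set.countable_range ((↑) : ℚ → ℝ))
  have happ : (fun _ => ξ) ∈ approxSet 1 fun X => X ^ (-X) := by
    refine hfreq.mono ?_
    rintro X ⟨-, x, hx, hxξ⟩
    exact ⟨fun _ => x, fun _ => hx, fun _ => hxξ⟩
  obtain ⟨ζ, hind, -, hζ⟩ := exists_independentWithOne_approxSet hψ hξ happ m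
  refine ⟨ζ, hind, EReal.eq_top_iff_forall_lt _ |>.mpr fun b => ?_⟩
  have hpos : 0 < max b 0 + 1 := by positivity
  refine lt_of_lt_of_le (b := ((max b 0 + 1 : ℝ) : EReal)) ?_ (le_chi hpos ?_)
  · rw [EReal.coe_lt_coe_iff]
    linarith [le_max_left b 0]
  · refine (hζ.and_eventually ((eventually_ge_atTop 1).and
      (eventually_ge_atTop (max b 0 + 1)))).mono ?_
    rintro X ⟨⟨x, hx, hxζ⟩, h1, hX⟩
    exact ⟨x, hx, fun j => (hxζ j).trans
      (Real.rpow_le_rpow_of_exponent_le h1 (neg_le_neg hX))⟩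

theorem mainTheorem5 (k : ℕ) (hk : 1 ≤ k) :
    chiSpectrum k = Set.Icc (1 : EReal) ⊤ := by
  obtain ⟨m, rfl⟩ := Nat.exists_eq_add_of_le' hk
  refine Set.Subset.antisymm ?_ ?_
  · rintro _ ⟨ζ, -, rfl⟩
    exact ⟨one_le_chi ζ, le_top⟩
  · rintro e ⟨he, -⟩
    induction e with
    | bot => exact absurd (le_bot_iff.mp he) (EReal.coe_ne_bot 1)
    | coe w => exact coe_mem_chiSpectrum_succ (by exact_mod_cast he) m
    | top => exact top_mem_chiSpectrum_succ m
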